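/- For $N,w\ge 1$, the problem $\mathsf{ApxCount}_{N,w}$ is: given a membership oracle for a set $A\subseteq[N]=\{1,\dots,N\}$ promised that either $|A|\le w$ (a "no" instance) or $|A|\ge 2w$ (a "yes" instance), decide which is the case. A $\mathsf{QMA}$ verifier with an $m$-qubit witness and $T$ queries is a quantum query algorithm that starts in $|\psi\rangle\otimes|0\cdots0\rangle$, where $|\psi\rangle$ is an $m$-qubit state (the witness), with any number of ancillas, applies $U_T O_A U_{T-1}\cdots O_A U_0$ with arbitrary unitaries $U_0,\dots,U_T$ independent of $A$ and the query unitary $O_A|i,b,z\rangle=|i,b\oplus[i\in A],z\rangle$ (on a blank index $i$, $O_A$ acts as the identity), and then measures in the computational basis and accepts if the outcome lies in a fixed set. It solves the problem with soundness and completeness errors $1/3$ if for every yes instance $A$ some $m$-qubit unit vector $|\psi\rangle$ is accepted with probability at least $2/3$, and for every no instance $A$ every $m$-qubit unit vector is accepted with probability at most $1/3$. There is an absolute constant $c>0$ such that for all integers $w\ge 1$, $N\ge 2w$, $m\ge 1$ and $T\ge 0$: if there is a $\mathsf{QMA}$ verifier for $\mathsf{ApxCount}_{N,w}$ with soundness and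 completeness errors $1/3$ that receives an $m$-qubit witness and makes $T$ queries to the membership oracle for $A$, then $$m\cdot T\;\ge\; c\cdot\min\left\{\sqrt{w},\sqrt{N/w}\right\}.$$ -/

import Mathlib

open scoped Matrix

/-- A promise problem about an unknown subset `A ⊆ [N]` that is given by a membership oracle.
The set `[N]` has `N` elements and is represented by `Fin N`. -/
structure OracleProblem (N : ℕ) where
  yes : Set (Finset (Fin N))
  no : Set (Finset (Fin N))

/-- Approximate counting: distinguish `|A| ≥ 2w` ("yes") from `|A| ≤ w` ("no"). -/
def apxCount (N w : ℕ) : OracleProblem N where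
  yes := {A | 2 * w ≤ A.card}
  no := {A | A.card ≤ w}

/-- Computational basis of the register of a verifier: a query index (`none` is a blank index,
whose query does nothing), an answer qubit, the `m` witness qubits and `a` ancilla qubits. -/
abbrev RegBasis (N m a : ℕ) : Type :=
  Option (Fin N) × Bool × (Fin m → Bool) × (Fin a → Bool)

/-- Membership of a query index in `A`, as a bit; the blank index is answered by `false`. -/
def memBit {N : ℕ} (A : Finset (Fin N)) : Option (Fin N) → Bool
  | none => false
  | some i => decide (i ∈ A)

/-- The unitary of one query to the membership oracle of `A`:
`|i, b, y, z⟩ ↦ |i, b ⊕ [i ∈ A], y, z⟩`. -/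
def queryMatrix {N : ℕ} (m a : ℕ) (A : Finset (Fin N)) :
    Matrix (RegBasis N m a) (RegBasis N m a) ℂ :=
  fun r s => if r = (s.1, xor s.2.1 (memBit A s.1), s.2.2) then 1 else 0

/-- A quantum verifier with a membership oracle for a subset of `[N]`, which receives an `m`-qubit
witness and makes `T` queries: it applies `U₀`, then a query, then `U₁`, then a query, ..., then
a query, then `U_T`, where the `U_t` are arbitrary unitaries on its whole register that do not
depend on the oracle. Finally it measures in the computational basis and accepts if the outcome
lies in `accept`. The number of ancilla qubits is arbitrary. -/
structure QueryVerifier (N m T : ℕ) where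
  ancillas : ℕ
  U : Fin (T + 1) → Matrix.unitaryGroup (RegBasis N m ancillas) ℂ
  accept : Finset (RegBasis N m ancillas)

namespace QueryVerifier

variable {N m T : ℕ}

/-- The initial state `|none⟩ ⊗ |0⟩ ⊗ |ψ⟩ ⊗ |0 ⋯ 0⟩` on the witness `ψ`. -/
def initState (V : QueryVerifier N m T) (ψ : EuclideanSpace ℂ (Fin m → Bool)) :
    RegBasis N m V.ancillas → ℂ :=
  fun r => if r.1 = none ∧ r.2.1 = false ∧ r.2.2.2 = (fun _ => false) then ψ r.2.2.1 else 0

/-- The state after the `t`-th query and the unitary that follows it. -/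
def state (V : QueryVerifier N m T) (A : Finset (Fin N)) (ψ : EuclideanSpace ℂ (Fin m → Bool)) :
    (t : ℕ) → t ≤ T → RegBasis N m V.ancillas → ℂ
  | 0, _ => (V.U 0).val *ᵥ V.initState ψ
  | t + 1, h =>
    (V.U ⟨t + 1, Nat.lt_succ_of_le h⟩).val *ᵥ
      (queryMatrix m V.ancillas A *ᵥ V.state A ψ t (Nat.le_of_succ_le h))

/-- The probability that the verifier accepts the witness `ψ` (a unit vector) with oracle `A`. -/
noncomputable def acceptProb (V : QueryVerifier N m T) (A : Finset (Fin N))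
    (ψ : EuclideanSpace ℂ (Fin m → Bool)) : ℝ :=
  ∑ r ∈ V.accept, ‖V.state A ψ T le_rfl r‖ ^ 2

/-- `V` is a QMA verifier for `P` whose completeness and soundness errors are at most `ε`: on yes
instances some `m`-qubit state is accepted with probability at least `1 - ε`, and on no instances
every `m`-qubit state is accepted with probability at most `ε`. -/
def IsQMAVerifier (V : QueryVerifier N m T) (P : OracleProblem N) (ε : ℝ) : Prop :=
  (∀ A ∈ P.yes, ∃ ψ : EuclideanSpace ℂ (Fin m → Bool), ‖ψ‖ = 1 ∧ 1 - ε ≤ V.acceptProb A ψ) ∧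
  (∀ A ∈ P.no, ∀ ψ : EuclideanSpace ℂ (Fin m → Bool), ‖ψ‖ = 1 → V.acceptProb A ψ ≤ ε)

end QueryVerifier

open Polynomial

/-! For a fixed oracle the acceptance probability is a quadratic form in the witness. Its matrix
`acceptMatrix` has size 2^m, eigenvalues in [0, 1], and entries that are polynomials of degree at
most 2T in the membership bits. The trace of its k-th power eliminates the witness: it is at least
(2/3)^k on yes instances, at most 2^m / 3^k on no instances, and at most 2^m always. Taking k = 13m
lets the powers outweigh the dimension 2^m. Averaging over the sets of size j gives a real
polynomial P(j) of degree at most 26mT (`exists_polynomial_moment`).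

The Laurent polynomial P(2ws) P(2w/s) is invariant under s ↦ 1/s, hence a polynomial Q in u = (s +
1/s)/2 (`exists_eval_cosh_eq_mul`). For 2 ≤ s ≤ N/(2w) one argument lies in [0, w], where P is tiny,
and the other in [0, N], where P is at most about 2^m. So Q is small for u from 5/4 to about N/w,
and a Chebyshev growth bound carries this to Q(1) = P(2w)² (`sq_eval_two_mul_le`), contradicting the
completeness bound when the degree is small. The term √w comes from passing from integers to reals
on [0, w], the term √(N/w) from the length of the u-interval. -/

/-! ### Chebyshev growth and Markov-type bounds for real polynomials. -/

/-- With 1 + μ = cosh θ the value is cosh(dθ) ≤ exp((dθ)²/2). Since θ² ≤ 2μ, the exponent is at most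
1/2, and √e < 2. -/
theorem eval_chebyshev_T_le_two {d : ℕ} {μ : ℝ} (hμ : 0 ≤ μ) (hd : 2 * (d : ℝ) ^ 2 * μ ≤ 1) :
    (Chebyshev.T ℝ d).eval (1 + μ) ≤ 2 := by
  have hc : Real.cosh (Real.arcosh (1 + μ)) = 1 + μ := Real.cosh_arcosh (by linarith)
  set θ := Real.arcosh (1 + μ)
  have hsq : θ ^ 2 ≤ 2 * μ := by
    have h : 1 + θ ^ 2 / 2 ≤ Real.cosh θ := by
      have h1 : Real.cosh θ = 2 * Real.sinh (θ / 2) ^ 2 + 1 := by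
        have := Real.cosh_two_mul (θ / 2)
        have h2 := Real.cosh_sq (θ / 2)
        rw [show 2 * (θ / 2) = θ by ring] at this
        rw [this, h2]; ring
      have h3 : (θ / 2) ^ 2 ≤ Real.sinh (θ / 2) ^ 2 := by
        rw [sq_le_sq, Real.abs_sinh]
        exact Real.self_le_sinh_iff.2 (abs_nonneg _)
      rw [h1]; nlinarith
    linarith
  rw [← hc, Chebyshev.T_real_cosh]
  refine (Real.cosh_le_exp_half_sq _).trans ?_
  have h4 : (((d : ℤ) : ℝ) * θ) ^ 2 / 2 ≤ 1 / 2 := by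
    push_cast
    rw [mul_pow]
    nlinarith [sq_nonneg (d : ℝ)]
  refine (Real.exp_le_exp.2 h4).trans ?_
  have h5 : Real.exp (1 / 2) ^ 2 = Real.exp 1 := by
    rw [← Real.exp_nat_mul]; norm_num
  have := Real.exp_one_lt_d9
  nlinarith [Real.exp_pos (1 / 2)]

/-- Rescaled extremality of Chebyshev polynomials. The case k = 0 gives growth outside the interval,
and k = 1 at x = 1 gives Markov's inequality at an endpoint. -/
theorem eval_iterate_derivative_le_mul {n : ℕ} {P : ℝ[X]} {k : ℕ} {x B : ℝ} (hx : 1 ≤ x)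
    (hPdeg : P.degree ≤ n) (hB : ∀ x ∈ Set.Icc (-1) 1, |P.eval x| ≤ B) :
    (derivative^[k] P).eval x ≤ B * (derivative^[k] (Chebyshev.T ℝ n)).eval x := by
  have h0 : ∀ C : ℝ, 0 < C → (∀ x ∈ Set.Icc (-1) 1, |P.eval x| ≤ C) →
      (derivative^[k] P).eval x ≤ C * (derivative^[k] (Chebyshev.T ℝ n)).eval x := by
    intro C hC h
    have := Chebyshev.eval_iterate_derivative_le_of_forall_abs_le_one (k := k) (P := C⁻¹ • P) hx
      ((degree_smul_le _ _).trans hPdeg) (by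
        intro y hy
        rw [eval_smul, smul_eq_mul, abs_mul, abs_of_pos (inv_pos.2 hC)]
        rw [inv_mul_le_iff₀ hC, mul_one]
        exact h y hy)
    rw [Polynomial.iterate_derivative_smul, eval_smul, smul_eq_mul, inv_mul_le_iff₀ hC] at this
    exact this
  have hB0 : 0 ≤ B := (abs_nonneg _).trans (hB 0 (by simp))
  -- B may be 0, where rescaling by B⁻¹ is useless, so C > B tends to B.
  rw [← sub_nonneg]
  have : Filter.Tendsto (fun C : ℝ => C * (derivative^[k] (Chebyshev.T ℝ n)).eval x -
      (derivative^[k] P).eval x) (nhdsWithin B (Set.Ioi B))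
      (nhds (B * (derivative^[k] (Chebyshev.T ℝ n)).eval x - (derivative^[k] P).eval x)) :=
    (Continuous.tendsto (by fun_prop) B).mono_left nhdsWithin_le_nhds
  refine ge_of_tendsto this ?_
  filter_upwards [self_mem_nhdsWithin] with C hC
  rw [Set.mem_Ioi] at hC
  exact sub_nonneg.2 (h0 C (by linarith) fun y hy => (hB y hy).trans hC.le)

/-- Growth of a bounded polynomial to the left of the interval on which it is bounded. -/
theorem eval_le_two_mul_of_abs_le {d : ℕ} {Q : ℝ[X]} (hQ : Q.degree ≤ d) {a b x B : ℝ}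
    (hab : a < b) (hx : x ≤ a) (hd : 4 * (d : ℝ) ^ 2 * (a - x) ≤ b - a)
    (hB : ∀ u ∈ Set.Icc a b, |Q.eval u| ≤ B) : Q.eval x ≤ 2 * B := by
  have hba : 0 < b - a := sub_pos.2 hab
  have hB0 : 0 ≤ B := (abs_nonneg _).trans (hB a ⟨le_rfl, hab.le⟩)
  -- The affine map reverses orientation: 1 goes to a and 1 + μ to x.
  set L : ℝ[X] := C ((a + b) / 2) - C ((b - a) / 2) * X with hL
  have hLd : L.natDegree ≤ 1 := by
    rw [hL]; compute_degree
  have hcomp : (Q.comp L).degree ≤ d := by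
    rw [← natDegree_le_iff_degree_le] at hQ ⊢
    refine natDegree_comp_le.trans ?_
    nlinarith
  have hLe : ∀ y, L.eval y = (a + b) / 2 - (b - a) / 2 * y := by intro y; simp [hL]
  set μ := 2 * (a - x) / (b - a)
  have hμ : 0 ≤ μ := div_nonneg (by linarith) hba.le
  have hLμ : L.eval (1 + μ) = x := by
    rw [hLe]; simp only [μ]; field_simp; ring
  have h := eval_iterate_derivative_le_mul (k := 0) (P := Q.comp L) (B := B)
    (x := 1 + μ) (by linarith) hcomp (by
      intro y hy
      rw [eval_comp, hLe]
      refine hB _ ⟨?_, ?_⟩ <;> nlinarith [hy.1, hy.2])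
  simp only [Function.iterate_zero, id, eval_comp, hLμ] at h
  refine h.trans ?_
  rw [mul_comm]
  refine mul_le_mul_of_nonneg_right (eval_chebyshev_T_le_two hμ ?_) hB0
  simp only [μ]
  rw [← mul_div_assoc, div_le_one hba]
  linarith

/-- Markov's inequality at an endpoint, from T_d'(1) = d². The order of a and b is left free so that
b can be either end of the interval. -/
theorem derivative_eval_le_endpoint {d : ℕ} {Q : ℝ[X]} (hQ : Q.degree ≤ d) {a b B : ℝ}
    (hab : a ≠ b) (hB : ∀ u ∈ Set.uIcc a b, |Q.eval u| ≤ B) :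
    |(derivative Q).eval b| ≤ 2 * (d : ℝ) ^ 2 / |b - a| * B := by
  have hba : 0 < |b - a| := abs_pos.2 (sub_ne_zero.2 hab.symm)
  set L : ℝ[X] := C ((a + b) / 2) + C ((b - a) / 2) * X with hL
  have hLd : L.natDegree ≤ 1 := by
    rw [hL]; compute_degree
  have hLe : ∀ y, L.eval y = (a + b) / 2 + (b - a) / 2 * y := by intro y; simp [hL]
  have hmem : ∀ y ∈ Set.Icc (-1 : ℝ) 1, L.eval y ∈ Set.uIcc a b := by
    intro y hy
    rw [hLe]
    rcases le_total a b with h | h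
    · rw [Set.uIcc_of_le h]; constructor <;> nlinarith [hy.1, hy.2]
    · rw [Set.uIcc_of_ge h]; constructor <;> nlinarith [hy.1, hy.2]
  have key : ∀ R : ℝ[X], R.degree ≤ d → (∀ u ∈ Set.uIcc a b, |R.eval u| ≤ B) →
      (b - a) / 2 * (derivative R).eval b ≤ B * (d : ℝ) ^ 2 := by
    intro R hR hRB
    have hcomp : (R.comp L).degree ≤ d := by
      rw [← natDegree_le_iff_degree_le] at hR ⊢
      refine natDegree_comp_le.trans ?_
      nlinarith
    have h := eval_iterate_derivative_le_mul (k := 1) (P := R.comp L) (B := B)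
      (x := 1) le_rfl hcomp (by
        intro y hy
        rw [eval_comp]
        exact hRB _ (hmem y hy))
    have hL1 : L.eval 1 = b := by rw [hLe]; ring
    have hL' : derivative L = C ((b - a) / 2) := by simp [hL]
    have hT : (derivative (Chebyshev.T ℝ d)).eval 1 = (d : ℝ) ^ 2 := by
      rw [Chebyshev.T_derivative_eq_U]
      simp [sq]
    simpa [derivative_comp, hL1, hL', hT] using h
  have h1 := key Q hQ hB
  have h2 := key (-Q) (by simpa using hQ) (by simpa using hB)
  simp only [derivative_neg, eval_neg] at h2
  have h3 : |(b - a) / 2 * (derivative Q).eval b| ≤ B * (d : ℝ) ^ 2 :=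
    abs_le.2 ⟨by linarith, h1⟩
  rw [abs_mul, abs_div, abs_two] at h3
  rw [div_mul_eq_mul_div, le_div_iff₀ hba]
  linarith

/-- A polynomial of degree at most `√L / 2` that is bounded by `B` on the integers of `[0, L]` is
bounded by `2 B` on the whole interval. -/
theorem abs_eval_le_two_mul_of_nat {d L : ℕ} {P : ℝ[X]} (hP : P.degree ≤ d) (hL : 0 < L)
    (hd : 4 * d ^ 2 ≤ L) {B : ℝ} (hB : ∀ j : ℕ, j ≤ L → |P.eval (j : ℝ)| ≤ B)
    {x : ℝ} (hx : x ∈ Set.Icc (0 : ℝ) L) : |P.eval x| ≤ 2 * B := by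
  have hL' : (0 : ℝ) < L := by exact_mod_cast hL
  obtain ⟨x₀, hx₀, hmax⟩ := isCompact_Icc.exists_isMaxOn (Set.nonempty_Icc.2 hL'.le)
    (f := fun y => |P.eval y|) (by fun_prop : ContinuousOn _ (Set.Icc (0 : ℝ) L))
  set K := |P.eval x₀|
  have hK : ∀ y ∈ Set.Icc (0 : ℝ) L, |P.eval y| ≤ K := fun y hy => hmax hy
  have hK0 : 0 ≤ K := abs_nonneg _
  -- One of the endpoints 0, L is at distance at least L/2 from y; the endpoint bound applies to the
  -- segment joining it to y.
  have hder : ∀ y ∈ Set.Icc (0 : ℝ) L, ‖deriv (fun z => P.eval z) y‖ ≤ 4 * (d : ℝ) ^ 2 / L * K := by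
    intro y hy
    rw [Polynomial.deriv, Real.norm_eq_abs]
    have aux : ∀ a ∈ Set.Icc (0 : ℝ) L, (L : ℝ) / 2 ≤ |y - a| →
        |(derivative P).eval y| ≤ 4 * (d : ℝ) ^ 2 / L * K := by
      intro a ha hay
      have hne : a ≠ y := by
        rintro rfl
        rw [sub_self, abs_zero] at hay
        linarith
      refine (derivative_eval_le_endpoint hP hne (B := K) fun u hu =>
        hK u (Set.uIcc_subset_Icc ha hy hu)).trans ?_
      refine mul_le_mul_of_nonneg_right ?_ hK0
      rw [div_le_div_iff₀ (by linarith) hL']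
      nlinarith [sq_nonneg (d : ℝ)]
    rcases le_total (y : ℝ) (L / 2) with h | h
    · refine aux L ⟨hL'.le, le_rfl⟩ ?_
      rw [abs_sub_comm]
      exact le_trans (by linarith) (le_abs_self _)
    · refine aux 0 ⟨le_rfl, hL'.le⟩ ?_
      exact le_trans (by linarith) (le_abs_self _)
  have hround : ∃ j : ℕ, j ≤ L ∧ |x₀ - j| ≤ 1 / 2 := by
    refine ⟨⌊x₀ + 1 / 2⌋₊, ?_, ?_⟩
    · have : ⌊x₀ + 1 / 2⌋₊ < L + 1 := by
        rw [Nat.floor_lt (by linarith [hx₀.1])]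
        push_cast; linarith [hx₀.2]
      omega
    · have h1 := Nat.floor_le (show 0 ≤ x₀ + 1 / 2 by linarith [hx₀.1])
      have h2 := Nat.lt_floor_add_one (x₀ + 1 / 2)
      rw [abs_le]; constructor <;> linarith
  obtain ⟨j, hjL, hj⟩ := hround
  have hjmem : (j : ℝ) ∈ Set.Icc (0 : ℝ) L := ⟨by positivity, by exact_mod_cast hjL⟩
  have hmv := (convex_Icc (0 : ℝ) L).norm_image_sub_le_of_norm_deriv_le
    (f := fun z => P.eval z) (fun y _ => P.differentiableAt) hder hjmem hx₀
  rw [Real.norm_eq_abs, Real.norm_eq_abs] at hmv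
  have hd' : 4 * (d : ℝ) ^ 2 ≤ L := by exact_mod_cast hd
  have hfrac : 4 * (d : ℝ) ^ 2 / L * K ≤ K := by
    rw [div_mul_eq_mul_div, div_le_iff₀ hL']; nlinarith
  -- The derivative is at most K and some integer lies within 1/2 of the maximizer, so the maximum K
  -- can be absorbed.
  have hKB : K ≤ B + K / 2 := by
    have h1 : K ≤ |P.eval (j : ℝ)| + |P.eval x₀ - P.eval (j : ℝ)| := by
      have := abs_add_le (P.eval (j : ℝ)) (P.eval x₀ - P.eval (j : ℝ))
      simpa [K] using this
    have h2 : 4 * (d : ℝ) ^ 2 / L * K * |x₀ - j| ≤ K * (1 / 2) :=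
      mul_le_mul hfrac hj (abs_nonneg _) hK0
    linarith [hB j hjL]
  linarith [hK x hx]

/-! ### Symmetric Laurent polynomials. -/

/-- The symmetric Laurent polynomial `s ↦ P (c s) P (c / s)` is a polynomial in
`(s + 1 / s) / 2`. -/
theorem exists_eval_cosh_eq_mul {d : ℕ} {P : ℝ[X]} (hP : P.natDegree ≤ d) (c : ℝ) :
    ∃ Q : ℝ[X], Q.degree ≤ d ∧ ∀ θ : ℝ,
      Q.eval (Real.cosh θ) = P.eval (c * Real.exp θ) * P.eval (c * Real.exp (-θ)) := by
  set b : ℕ → ℝ := fun i => P.coeff i * c ^ i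
  refine ⟨∑ i ∈ Finset.range (d + 1), ∑ j ∈ Finset.range (d + 1),
    (b i * b j) • Chebyshev.T ℝ ((i : ℤ) - j), ?_, ?_⟩
  · refine (degree_sum_le _ _).trans (Finset.sup_le fun i hi => ?_)
    refine (degree_sum_le _ _).trans (Finset.sup_le fun j hj => ?_)
    refine (degree_smul_le _ _).trans ?_
    rw [Chebyshev.degree_T]
    rw [Finset.mem_range] at hi hj
    exact_mod_cast (by omega : ((i : ℤ) - j).natAbs ≤ d)
  · intro θ
    have hev : ∀ η : ℝ, P.eval (c * Real.exp η) =
        ∑ i ∈ Finset.range (d + 1), b i * Real.exp (i * η) := by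
      intro η
      rw [eval_eq_sum_range' (Nat.lt_succ_of_le hP)]
      refine Finset.sum_congr rfl fun i _ => ?_
      rw [mul_pow, ← Real.exp_nat_mul, mul_assoc]
    have hprod : P.eval (c * Real.exp θ) * P.eval (c * Real.exp (-θ)) =
        ∑ i ∈ Finset.range (d + 1), ∑ j ∈ Finset.range (d + 1),
          b i * b j * Real.exp (((i : ℝ) - j) * θ) := by
      rw [hev, hev, Finset.sum_mul_sum]
      refine Finset.sum_congr rfl fun i _ => Finset.sum_congr rfl fun j _ => ?_
      rw [mul_mul_mul_comm, ← Real.exp_add]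
      ring_nf
    -- Exchanging i and j flips the sign of the exponent; averaging the two expansions turns
    -- exponentials into cosh((i - j)θ).
    have hprod' : P.eval (c * Real.exp θ) * P.eval (c * Real.exp (-θ)) =
        ∑ i ∈ Finset.range (d + 1), ∑ j ∈ Finset.range (d + 1),
          b i * b j * Real.exp (-(((i : ℝ) - j) * θ)) := by
      rw [hprod, Finset.sum_comm]
      refine Finset.sum_congr rfl fun i _ => Finset.sum_congr rfl fun j _ => ?_
      ring_nf
    have h2 : (2 : ℝ) * (∑ i ∈ Finset.range (d + 1), ∑ j ∈ Finset.range (d + 1),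
        (b i * b j) * Real.cosh (((i : ℝ) - j) * θ)) =
        2 * (P.eval (c * Real.exp θ) * P.eval (c * Real.exp (-θ))) := by
      rw [two_mul (P.eval _ * _)]
      nth_rewrite 1 [hprod]
      rw [hprod', ← Finset.sum_add_distrib, Finset.mul_sum]
      refine Finset.sum_congr rfl fun i _ => ?_
      rw [← Finset.sum_add_distrib, Finset.mul_sum]
      refine Finset.sum_congr rfl fun j _ => ?_
      rw [Real.cosh_eq]; ring
    simp only [eval_finsetSum, eval_smul, Chebyshev.T_real_cosh, smul_eq_mul]
    push_cast
    linarith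

/-! ### Polynomials in membership bits and their symmetrization. -/

/-- Complex functions of a subset of `[N]` that are polynomials of degree at most `d` in the
membership indicators. -/
def polyDegreeLE (N d : ℕ) : Submodule ℂ (Finset (Fin N) → ℂ) :=
  Submodule.span ℂ {f | ∃ S : Finset (Fin N), S.card ≤ d ∧ f = fun A => if S ⊆ A then 1 else 0}

namespace polyDegreeLE

variable {N d e : ℕ}

theorem indicator_mem {S : Finset (Fin N)} (hS : S.card ≤ d) :
    (fun A => if S ⊆ A then 1 else 0 : Finset (Fin N) → ℂ) ∈ polyDegreeLE N d :=
  Submodule.subset_span ⟨S, hS, rfl⟩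

theorem const_mem (c : ℂ) : (fun _ => c : Finset (Fin N) → ℂ) ∈ polyDegreeLE N d := by
  have h := (polyDegreeLE N d).smul_mem c (indicator_mem (S := ∅) (by simp))
  convert h using 1
  ext A
  simp

theorem mul_mem {f g : Finset (Fin N) → ℂ} (hf : f ∈ polyDegreeLE N d)
    (hg : g ∈ polyDegreeLE N e) : (fun A => f A * g A) ∈ polyDegreeLE N (d + e) := by
  have h : f * g ∈ polyDegreeLE N d * polyDegreeLE N e := Submodule.mul_mem_mul hf hg
  rw [polyDegreeLE, polyDegreeLE, Submodule.span_mul_span] at h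
  refine Submodule.span_mono ?_ h
  rintro _ ⟨_, ⟨S, hS, rfl⟩, _, ⟨S', hS', rfl⟩, rfl⟩
  refine ⟨S ∪ S', (Finset.card_union_le _ _).trans (add_le_add hS hS'), ?_⟩
  ext A
  by_cases h1 : S ⊆ A <;> by_cases h2 : S' ⊆ A <;> simp [Finset.union_subset_iff, h1, h2]

theorem star_mem {f : Finset (Fin N) → ℂ} (hf : f ∈ polyDegreeLE N d) :
    (fun A => star (f A)) ∈ polyDegreeLE N d := by
  induction hf using Submodule.span_induction with
  | mem f hf =>
    obtain ⟨S, hS, rfl⟩ := hf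
    convert indicator_mem hS using 1
    ext A
    by_cases h : S ⊆ A <;> simp [h]
  | zero => simpa using const_mem (N := N) (d := d) 0
  | add f g _ _ hf hg =>
    simpa only [Pi.add_apply, star_add, Pi.add_def] using Submodule.add_mem _ hf hg
  | smul c f _ hf =>
    simpa only [Pi.smul_apply, smul_eq_mul, star_mul', Pi.smul_def] using
      Submodule.smul_mem _ (star c) hf

theorem sum_mem {ι : Type*} {s : Finset ι} {f : ι → Finset (Fin N) → ℂ}
    (hf : ∀ i ∈ s, f i ∈ polyDegreeLE N d) : (fun A => ∑ i ∈ s, f i A) ∈ polyDegreeLE N d := by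
  have h := Submodule.sum_mem _ hf
  convert h using 1
  ext A
  simp

/-- A function of one membership bit has degree at most one. -/
theorem comp_decide_mem (i : Fin N) (g : Bool → ℂ) :
    (fun A => g (decide (i ∈ A)) : Finset (Fin N) → ℂ) ∈ polyDegreeLE N 1 := by
  have h := Submodule.add_mem _ (const_mem (N := N) (d := 1) (g false))
    (Submodule.smul_mem _ (g true - g false) (indicator_mem (S := {i}) (d := 1) (by simp)))
  convert h using 1
  ext A
  by_cases hi : i ∈ A <;> simp [hi]

section Matrix

variable {m n p : Type*}

theorem matrix_mul [Fintype n] {F : Finset (Fin N) → Matrix m n ℂ}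
    {G : Finset (Fin N) → Matrix n p ℂ} (hF : ∀ i j, (fun A => F A i j) ∈ polyDegreeLE N d)
    (hG : ∀ i j, (fun A => G A i j) ∈ polyDegreeLE N e) (i : m) (j : p) :
    (fun A => (F A * G A) i j) ∈ polyDegreeLE N (d + e) := by
  simp only [Matrix.mul_apply]
  exact sum_mem fun k _ => mul_mem (hF i k) (hG k j)

theorem matrix_pow [Fintype n] [DecidableEq n] {F : Finset (Fin N) → Matrix n n ℂ}
    (hF : ∀ i j, (fun A => F A i j) ∈ polyDegreeLE N d) (k : ℕ) (i j : n) :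
    (fun A => (F A ^ k) i j) ∈ polyDegreeLE N (d * k) := by
  induction k generalizing i j with
  | zero => simpa only [pow_zero] using const_mem _
  | succ k ih =>
    simp only [pow_succ]
    exact matrix_mul ih hF i j

end Matrix

end polyDegreeLE

/-- Double counting: C(N,j) C(j,s) = C(N,s) C(N-s,j-s). The average of the indicator is thus
C(j,s)/C(N,s), a polynomial in j of degree s. -/
theorem sum_powersetCard_indicator {N : ℕ} (j : ℕ) (S : Finset (Fin N)) :
    (∑ A ∈ Finset.powersetCard j (Finset.univ : Finset (Fin N)), if S ⊆ A then (1 : ℝ) else 0) =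
      N.choose j * (((N.choose S.card : ℝ))⁻¹ * (j.choose S.card : ℝ)) := by
  have hSN : S.card ≤ N := by simpa using S.card_le_univ
  have h0 : (N.choose S.card : ℝ) ≠ 0 := by
    exact_mod_cast (Nat.choose_pos hSN).ne'
  rw [← Finset.sum_filter, Finset.sum_const, nsmul_eq_mul, mul_one]
  by_cases hS : S.card ≤ j
  · rw [Finset.card_filter_powersetCard_subset S _ j (Finset.subset_univ _) hS, Finset.card_univ,
      Fintype.card_fin]
    have h := Nat.choose_mul (n := N) hS
    have h' : (N.choose j : ℝ) * j.choose S.card =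
        N.choose S.card * (N - S.card).choose (j - S.card) := by exact_mod_cast h
    field_simp
    linarith
  · rw [Nat.choose_eq_zero_of_lt (not_le.1 hS), Finset.filter_eq_empty_iff.2]
    · simp
    · intro A hA hSA
      exact hS ((Finset.card_le_card hSA).trans (Finset.mem_powersetCard.1 hA).2.le)

/-- Symmetrization: the average of a polynomial over the subsets of size `j` is a univariate
polynomial in `j` of no larger degree. -/
theorem exists_polynomial_sum_powersetCard {N d : ℕ} {f : Finset (Fin N) → ℂ}
    (hf : f ∈ polyDegreeLE N d) :
    ∃ P : ℝ[X], P.natDegree ≤ d ∧ ∀ j ≤ N,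
      ∑ A ∈ Finset.powersetCard j Finset.univ, (f A).re = N.choose j * P.eval (j : ℝ) := by
  -- Complex scalars mix real and imaginary parts, so the induction carries both.
  suffices h : (∃ P : ℝ[X], P.natDegree ≤ d ∧ ∀ j ≤ N,
      ∑ A ∈ Finset.powersetCard j Finset.univ, (f A).re = N.choose j * P.eval (j : ℝ)) ∧
      (∃ P : ℝ[X], P.natDegree ≤ d ∧ ∀ j ≤ N,
      ∑ A ∈ Finset.powersetCard j Finset.univ, (f A).im = N.choose j * P.eval (j : ℝ)) from h.1
  induction hf using Submodule.span_induction with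
  | mem f hf =>
    obtain ⟨S, hS, rfl⟩ := hf
    refine ⟨⟨((N.choose S.card : ℝ)⁻¹ * (S.card.factorial : ℝ)⁻¹) • descPochhammer ℝ S.card,
      (natDegree_smul_le _ _).trans (by simpa using hS), fun j _ => ?_⟩,
      ⟨0, by simp, fun j _ => ?_⟩⟩
    · have h := sum_powersetCard_indicator j S
      rw [Nat.cast_choose_eq_descPochhammer_div ℝ j S.card] at h
      rw [eval_smul, smul_eq_mul]
      convert h using 1
      · refine Finset.sum_congr rfl fun A _ => ?_
        by_cases hA : S ⊆ A <;> simp [hA]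
      · ring
    · rw [eval_zero, mul_zero]
      refine Finset.sum_eq_zero fun A _ => ?_
      by_cases hA : S ⊆ A <;> simp [hA]
  | zero => exact ⟨⟨0, by simp⟩, ⟨0, by simp⟩⟩
  | add f g _ _ hf hg =>
    obtain ⟨⟨P, hP, hPe⟩, P', hP', hPe'⟩ := hf
    obtain ⟨⟨Q, hQ, hQe⟩, Q', hQ', hQe'⟩ := hg
    refine ⟨⟨P + Q, natDegree_add_le_of_degree_le hP hQ, fun j hj => ?_⟩,
      ⟨P' + Q', natDegree_add_le_of_degree_le hP' hQ', fun j hj => ?_⟩⟩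
    · simp only [Pi.add_apply, Complex.add_re, Finset.sum_add_distrib, hPe j hj, hQe j hj, eval_add]
      ring
    · simp only [Pi.add_apply, Complex.add_im, Finset.sum_add_distrib, hPe' j hj, hQe' j hj,
        eval_add]
      ring
  | smul c f _ hf =>
    obtain ⟨⟨P, hP, hPe⟩, Q, hQ, hQe⟩ := hf
    refine ⟨⟨c.re • P - c.im • Q, ?_, fun j hj => ?_⟩, ⟨c.re • Q + c.im • P, ?_, fun j hj => ?_⟩⟩
    · exact (natDegree_sub_le_of_le ((natDegree_smul_le _ _).trans hP)
        ((natDegree_smul_le _ _).trans hQ)).trans_eq (max_self d)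
    · simp only [Pi.smul_apply, smul_eq_mul, Complex.mul_re, Finset.sum_sub_distrib,
        ← Finset.mul_sum, hPe j hj, hQe j hj, eval_sub, eval_smul]
      ring
    · exact natDegree_add_le_of_degree_le ((natDegree_smul_le _ _).trans hQ)
        ((natDegree_smul_le _ _).trans hP)
    · simp only [Pi.smul_apply, smul_eq_mul, Complex.mul_im, Finset.sum_add_distrib,
        ← Finset.mul_sum, hPe j hj, hQe j hj, eval_add, eval_smul]
      ring

/-! ### Spectra of Hermitian matrices and norm preservation. -/

theorem Matrix.IsHermitian.trace_pow_eq_sum_eigenvalues {n : Type*} [Fintype n] [DecidableEq n]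
    {M : Matrix n n ℂ} (hM : M.IsHermitian) (k : ℕ) :
    (M ^ k).trace = ∑ i, ((hM.eigenvalues i ^ k : ℝ) : ℂ) := by
  conv_lhs => rw [hM.spectral_theorem, ← map_pow, Unitary.conjStarAlgAut_apply,
    Matrix.trace_mul_cycle, Unitary.coe_star_mul_self, one_mul, Matrix.diagonal_pow,
    Matrix.trace_diagonal]
  simp

/-- If a Hermitian form is at least `c` at some unit vector, then some eigenvalue is. -/
theorem Matrix.IsHermitian.exists_le_eigenvalues {n : Type*} [Fintype n] [DecidableEq n]
    {M : Matrix n n ℂ} (hM : M.IsHermitian) {ψ : EuclideanSpace ℂ n} (hψ : ‖ψ‖ = 1) {c : ℝ}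
    (hc : c ≤ (star (⇑ψ) ⬝ᵥ M *ᵥ ⇑ψ).re) : ∃ i, c ≤ hM.eigenvalues i := by
  by_contra! h
  have hψ0 : ψ ≠ 0 := by rintro rfl; simp at hψ
  have hn : (∑ i, ‖inner ℂ (hM.eigenvectorBasis i) ψ‖ ^ 2 : ℝ) = 1 := by
    rw [hM.eigenvectorBasis.sum_sq_norm_inner_right, hψ, one_pow]
  have hsum : (star (⇑ψ) ⬝ᵥ M *ᵥ ⇑ψ).re =
      ∑ i, hM.eigenvalues i * ‖inner ℂ (hM.eigenvectorBasis i) ψ‖ ^ 2 := by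
    have h1 : M *ᵥ ⇑ψ = ∑ i, inner ℂ (hM.eigenvectorBasis i) ψ •
        ((hM.eigenvalues i : ℂ) • ⇑(hM.eigenvectorBasis i)) := by
      conv_lhs => rw [← hM.eigenvectorBasis.sum_repr' ψ]
      rw [WithLp.ofLp_sum, Matrix.mulVec_sum]
      refine Finset.sum_congr rfl fun i _ => ?_
      rw [WithLp.ofLp_smul, Matrix.mulVec_smul, hM.mulVec_eigenvectorBasis]
      rfl
    rw [h1, dotProduct_sum, Complex.re_sum]
    refine Finset.sum_congr rfl fun i _ => ?_
    have h2 : star (⇑ψ) ⬝ᵥ ⇑(hM.eigenvectorBasis i) = star (inner ℂ (hM.eigenvectorBasis i) ψ) := by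
      rw [dotProduct_comm, ← EuclideanSpace.inner_eq_star_dotProduct, Complex.star_def,
        inner_conj_symm]
    rw [dotProduct_smul, dotProduct_smul, h2, smul_eq_mul, smul_eq_mul, mul_left_comm,
      Complex.star_def, Complex.mul_conj, Complex.normSq_eq_norm_sq, ← Complex.ofReal_mul,
      Complex.ofReal_re]
  have hne : ∃ i, 0 < ‖inner ℂ (hM.eigenvectorBasis i) ψ‖ ^ 2 := by
    by_contra! h0
    have := Finset.sum_nonpos fun i (_ : i ∈ Finset.univ) => h0 i
    linarith
  obtain ⟨i₀, hi₀⟩ := hne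
  have hlt : ∑ i, hM.eigenvalues i * ‖inner ℂ (hM.eigenvectorBasis i) ψ‖ ^ 2 <
      ∑ i, c * ‖inner ℂ (hM.eigenvectorBasis i) ψ‖ ^ 2 :=
    Finset.sum_lt_sum (fun i _ => mul_le_mul_of_nonneg_right (h i).le (by positivity))
      ⟨i₀, Finset.mem_univ _, mul_lt_mul_of_pos_right (h i₀) hi₀⟩
  rw [← Finset.mul_sum, hn, mul_one] at hlt
  linarith

theorem sum_sq_norm_unitary_mulVec {n : Type*} [Fintype n] [DecidableEq n]
    (U : Matrix.unitaryGroup n ℂ) (v : n → ℂ) :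
    ∑ r, ‖(U.val *ᵥ v) r‖ ^ 2 = ∑ r, ‖v r‖ ^ 2 := by
  have key : ∀ w : n → ℂ, ((∑ r, ‖w r‖ ^ 2 : ℝ) : ℂ) = star w ⬝ᵥ w := by
    intro w
    rw [Complex.ofReal_sum]
    refine Finset.sum_congr rfl fun r _ => ?_
    rw [Pi.star_apply, Complex.star_def, Complex.conj_mul', Complex.ofReal_pow]
  have h : ((∑ r, ‖(U.val *ᵥ v) r‖ ^ 2 : ℝ) : ℂ) = ((∑ r, ‖v r‖ ^ 2 : ℝ) : ℂ) := by
    rw [key, key, Matrix.star_mulVec, Matrix.dotProduct_mulVec, Matrix.vecMul_vecMul,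
      ← Matrix.star_eq_conjTranspose, Matrix.mem_unitaryGroup_iff'.1 U.2, Matrix.vecMul_one]
  exact_mod_cast h

/-! ### Queries, evolution and the acceptance matrix. -/

section Query

variable {N m a : ℕ}

theorem queryMatrix_mulVec (A : Finset (Fin N)) (v : RegBasis N m a → ℂ) (r : RegBasis N m a) :
    (queryMatrix m a A *ᵥ v) r = v (r.1, xor r.2.1 (memBit A r.1), r.2.2) := by
  rw [Matrix.mulVec, dotProduct, Finset.sum_eq_single (r.1, xor r.2.1 (memBit A r.1), r.2.2)]
  · simp [queryMatrix]
  · intro s _ hs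
    have : r ≠ (s.1, xor s.2.1 (memBit A s.1), s.2.2) := by
      rintro rfl
      exact hs (by simp)
    simp [queryMatrix, this]
  · simp

theorem sum_sq_norm_queryMatrix_mulVec (A : Finset (Fin N)) (v : RegBasis N m a → ℂ) :
    ∑ r, ‖(queryMatrix m a A *ᵥ v) r‖ ^ 2 = ∑ r, ‖v r‖ ^ 2 := by
  have hinv : Function.Involutive
      (fun r : RegBasis N m a => ((r.1, xor r.2.1 (memBit A r.1), r.2.2) : RegBasis N m a)) := by
    intro r; simp
  simp only [queryMatrix_mulVec]
  exact Equiv.sum_comp hinv.toPerm (fun r => ‖v r‖ ^ 2)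

theorem queryMatrix_mem (r s : RegBasis N m a) :
    (fun A => queryMatrix m a A r s) ∈ polyDegreeLE N 1 := by
  obtain ⟨i | i, s⟩ := s
  · exact polyDegreeLE.const_mem (if r = (none, xor s.1 false, s.2) then 1 else 0)
  · exact polyDegreeLE.comp_decide_mem i fun b =>
      if r = (some i, xor s.1 b, s.2) then 1 else 0

end Query

namespace QueryVerifier

variable {N m T : ℕ} (V : QueryVerifier N m T)

/-- The isometry that maps a witness to the initial state. -/
def initMatrix : Matrix (RegBasis N m V.ancillas) (Fin m → Bool) ℂ :=
  fun r y => if r.1 = none ∧ r.2.1 = false ∧ r.2.2.2 = (fun _ => false) ∧ r.2.2.1 = y then 1 else 0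

theorem initState_eq (ψ : EuclideanSpace ℂ (Fin m → Bool)) :
    V.initState ψ = V.initMatrix *ᵥ ⇑ψ := by
  ext r
  by_cases h : r.1 = none ∧ r.2.1 = false ∧ r.2.2.2 = (fun _ => false)
  · simp [initState, initMatrix, Matrix.mulVec, dotProduct, h]
  · have h' : ∀ y, ¬ (r.1 = none ∧ r.2.1 = false ∧ r.2.2.2 = (fun _ => false) ∧ r.2.2.1 = y) :=
      fun y hy => h ⟨hy.1, hy.2.1, hy.2.2.1⟩
    simp [initState, initMatrix, Matrix.mulVec, dotProduct, h, h']

/-- The map from witnesses to states after `t` queries. -/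
def evolution (A : Finset (Fin N)) :
    (t : ℕ) → t ≤ T → Matrix (RegBasis N m V.ancillas) (Fin m → Bool) ℂ
  | 0, _ => (V.U 0).val * V.initMatrix
  | t + 1, h =>
    (V.U ⟨t + 1, Nat.lt_succ_of_le h⟩).val *
      (queryMatrix m V.ancillas A * evolution A t (Nat.le_of_succ_le h))

theorem state_eq (A : Finset (Fin N)) (ψ : EuclideanSpace ℂ (Fin m → Bool)) :
    ∀ (t : ℕ) (h : t ≤ T), V.state A ψ t h = V.evolution A t h *ᵥ ⇑ψ
  | 0, _ => by rw [state, evolution, initState_eq, Matrix.mulVec_mulVec]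
  | t + 1, h => by
    rw [state, evolution, state_eq A ψ t, Matrix.mulVec_mulVec, Matrix.mulVec_mulVec, Matrix.mul_assoc]

/-- Only the queries depend on `A`, and each raises the degree by at most one. -/
theorem evolution_mem : ∀ (t : ℕ) (h : t ≤ T) (r : RegBasis N m V.ancillas) (y : Fin m → Bool),
    (fun A => V.evolution A t h r y) ∈ polyDegreeLE N t
  | 0, _, r, y => polyDegreeLE.const_mem (((V.U 0).val * V.initMatrix) r y)
  | t + 1, h, r, y => by
    have := polyDegreeLE.matrix_mul (d := 0) (fun r s => polyDegreeLE.const_mem _)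
      (polyDegreeLE.matrix_mul queryMatrix_mem (evolution_mem t (Nat.le_of_succ_le h)))
      (F := fun _ => (V.U ⟨t + 1, Nat.lt_succ_of_le h⟩).val) r y
    rwa [zero_add, add_comm 1 t] at this

theorem sum_sq_norm_initState (ψ : EuclideanSpace ℂ (Fin m → Bool)) :
    ∑ r, ‖V.initState ψ r‖ ^ 2 = ‖ψ‖ ^ 2 := by
  rw [EuclideanSpace.norm_sq_eq]
  symm
  refine Finset.sum_of_injOn (fun y => (none, false, y, fun _ => false)) ?_ ?_ ?_ ?_
  · intro y _ y' _ h
    simpa using h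
  · simp
  · intro r _ hr
    rw [initState, if_neg, norm_zero, zero_pow two_ne_zero]
    rintro ⟨h1, h2, h3⟩
    exact hr ⟨r.2.2.1, by simp, Prod.ext h1.symm (Prod.ext h2.symm (Prod.ext rfl h3.symm))⟩
  · intro y _
    simp [initState]

theorem sum_sq_norm_state (A : Finset (Fin N)) (ψ : EuclideanSpace ℂ (Fin m → Bool)) :
    ∀ (t : ℕ) (h : t ≤ T), ∑ r, ‖V.state A ψ t h r‖ ^ 2 = ‖ψ‖ ^ 2
  | 0, _ => by rw [state, sum_sq_norm_unitary_mulVec, sum_sq_norm_initState]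
  | t + 1, h => by
    rw [state, sum_sq_norm_unitary_mulVec, sum_sq_norm_queryMatrix_mulVec,
      sum_sq_norm_state A ψ t]

theorem acceptProb_nonneg (A : Finset (Fin N)) (ψ : EuclideanSpace ℂ (Fin m → Bool)) :
    0 ≤ V.acceptProb A ψ :=
  Finset.sum_nonneg fun _ _ => by positivity

theorem acceptProb_le_one (A : Finset (Fin N)) {ψ : EuclideanSpace ℂ (Fin m → Bool)}
    (hψ : ‖ψ‖ = 1) : V.acceptProb A ψ ≤ 1 := by
  have h := V.sum_sq_norm_state A ψ T le_rfl
  rw [hψ, one_pow] at h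
  rw [← h]
  exact Finset.sum_le_sum_of_subset_of_nonneg (Finset.subset_univ _) fun _ _ _ => by positivity

/-- The Hermitian form of the acceptance probability on witnesses. -/
noncomputable def acceptMatrix (A : Finset (Fin N)) : Matrix (Fin m → Bool) (Fin m → Bool) ℂ :=
  fun y y' => ∑ r ∈ V.accept, star (V.evolution A T le_rfl r y) * V.evolution A T le_rfl r y'

theorem acceptMatrix_isHermitian (A : Finset (Fin N)) : (V.acceptMatrix A).IsHermitian := by
  ext y y'
  simp only [acceptMatrix, Matrix.conjTranspose_apply, star_sum, star_mul', star_star]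
  exact Finset.sum_congr rfl fun r _ => mul_comm _ _

theorem acceptMatrix_mem (y y' : Fin m → Bool) :
    (fun A => V.acceptMatrix A y y') ∈ polyDegreeLE N (2 * T) := by
  rw [two_mul]
  exact polyDegreeLE.sum_mem fun r _ => polyDegreeLE.mul_mem
    (polyDegreeLE.star_mem (V.evolution_mem T le_rfl r y)) (V.evolution_mem T le_rfl r y')

theorem dotProduct_acceptMatrix_mulVec (A : Finset (Fin N))
    (ψ : EuclideanSpace ℂ (Fin m → Bool)) :
    star (⇑ψ) ⬝ᵥ V.acceptMatrix A *ᵥ ⇑ψ = (V.acceptProb A ψ : ℂ) := by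
  have h1 : ∀ r, ((‖V.state A ψ T le_rfl r‖ ^ 2 : ℝ) : ℂ) =
      ∑ y, ∑ y', star (ψ y) * (star (V.evolution A T le_rfl r y) * V.evolution A T le_rfl r y') *
        ψ y' := by
    intro r
    rw [Complex.ofReal_pow, ← Complex.conj_mul', ← Complex.star_def, state_eq, Matrix.mulVec,
      dotProduct, star_sum, Finset.sum_mul_sum]
    refine Finset.sum_congr rfl fun y _ => Finset.sum_congr rfl fun y' _ => ?_
    rw [star_mul']
    ring
  rw [acceptProb, Complex.ofReal_sum, Finset.sum_congr rfl fun r _ => h1 r, Finset.sum_comm]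
  simp only [dotProduct, Matrix.mulVec, acceptMatrix, Pi.star_apply]
  refine Finset.sum_congr rfl fun y _ => ?_
  rw [Finset.sum_comm, Finset.mul_sum]
  refine Finset.sum_congr rfl fun y' _ => ?_
  rw [Finset.sum_mul, Finset.mul_sum]
  exact Finset.sum_congr rfl fun r _ => by ring

/-- Each eigenvalue is itself an acceptance probability, so it inherits positivity and the soundness
bound. -/
theorem eigenvalues_acceptMatrix (A : Finset (Fin N)) (y : Fin m → Bool) :
    (V.acceptMatrix_isHermitian A).eigenvalues y =
      V.acceptProb A ((V.acceptMatrix_isHermitian A).eigenvectorBasis y) := by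
  rw [Matrix.IsHermitian.eigenvalues_eq, dotProduct_acceptMatrix_mulVec]
  exact Complex.ofReal_re _

theorem re_trace_acceptMatrix_pow (A : Finset (Fin N)) (k : ℕ) :
    ((V.acceptMatrix A ^ k).trace).re =
      ∑ y, (V.acceptMatrix_isHermitian A).eigenvalues y ^ k := by
  rw [(V.acceptMatrix_isHermitian A).trace_pow_eq_sum_eigenvalues, Complex.re_sum]
  exact Finset.sum_congr rfl fun _ _ => Complex.ofReal_re _

theorem re_trace_acceptMatrix_pow_nonneg (A : Finset (Fin N)) (k : ℕ) :
    0 ≤ ((V.acceptMatrix A ^ k).trace).re := by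
  rw [re_trace_acceptMatrix_pow]
  refine Finset.sum_nonneg fun y _ => pow_nonneg ?_ k
  rw [eigenvalues_acceptMatrix]
  exact V.acceptProb_nonneg A _

theorem re_trace_acceptMatrix_pow_le {A : Finset (Fin N)} {ε : ℝ} (k : ℕ)
    (h : ∀ ψ : EuclideanSpace ℂ (Fin m → Bool), ‖ψ‖ = 1 → V.acceptProb A ψ ≤ ε) :
    ((V.acceptMatrix A ^ k).trace).re ≤ 2 ^ m * ε ^ k := by
  rw [re_trace_acceptMatrix_pow]
  refine (Finset.sum_le_card_nsmul _ _ (ε ^ k) fun y _ => ?_).trans_eq (by simp)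
  rw [eigenvalues_acceptMatrix]
  exact pow_le_pow_left₀ (V.acceptProb_nonneg A _)
    (h _ ((V.acceptMatrix_isHermitian A).eigenvectorBasis.norm_eq_one y)) k

theorem le_re_trace_acceptMatrix_pow {A : Finset (Fin N)} {c : ℝ} (hc : 0 ≤ c) (k : ℕ)
    {ψ : EuclideanSpace ℂ (Fin m → Bool)} (hψ : ‖ψ‖ = 1) (h : c ≤ V.acceptProb A ψ) :
    c ^ k ≤ ((V.acceptMatrix A ^ k).trace).re := by
  obtain ⟨y, hy⟩ := (V.acceptMatrix_isHermitian A).exists_le_eigenvalues hψ (c := c) (by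
    rw [dotProduct_acceptMatrix_mulVec, Complex.ofReal_re]
    exact h)
  rw [re_trace_acceptMatrix_pow]
  refine (pow_le_pow_left₀ hc hy k).trans (Finset.single_le_sum
    (f := fun y => (V.acceptMatrix_isHermitian A).eigenvalues y ^ k) (fun y _ => ?_)
    (Finset.mem_univ y))
  refine pow_nonneg ?_ k
  rw [eigenvalues_acceptMatrix]
  exact V.acceptProb_nonneg A _

/-- The polynomial method for verifiers: the `k`-th moment of the acceptance matrix, averaged over
the sets of a given size, is a polynomial in that size. -/
theorem exists_polynomial_moment (k : ℕ) :
    ∃ P : ℝ[X], P.natDegree ≤ 2 * T * k ∧ ∀ j ≤ N,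
      ∑ A ∈ Finset.powersetCard j Finset.univ, ((V.acceptMatrix A ^ k).trace).re =
        N.choose j * P.eval (j : ℝ) :=
  exists_polynomial_sum_powersetCard
    (polyDegreeLE.sum_mem fun y _ => polyDegreeLE.matrix_pow V.acceptMatrix_mem k y y)

end QueryVerifier

/-! ### The Laurent polynomial method and the lower bound. -/

/-- The Laurent polynomial method: a polynomial that is at most `B` on the integers of `[0, w]`, at
most `C` on those of `[0, N]` and of degree well below `min √w √(N / w)` is not much larger than
`√(B C)` at `2 w`. -/
theorem sq_eval_two_mul_le {N w d : ℕ} (hw : 1 ≤ w) (hN : 10 * w ≤ N) {P : ℝ[X]}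
    (hP : P.natDegree ≤ d) (hdw : 4 * d ^ 2 ≤ w) (hdN : 8 * d ^ 2 * w ≤ N) {B C : ℝ}
    (hB : ∀ j : ℕ, j ≤ w → |P.eval (j : ℝ)| ≤ B) (hC : ∀ j : ℕ, j ≤ N → |P.eval (j : ℝ)| ≤ C) :
    P.eval (2 * w : ℝ) ^ 2 ≤ 8 * (B * C) := by
  have hPd : P.degree ≤ d := natDegree_le_iff_degree_le.1 hP
  have hw0 : (0 : ℝ) < w := by exact_mod_cast hw
  have hN' : (10 : ℝ) * w ≤ N := by exact_mod_cast hN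
  obtain ⟨Q, hQ, hQe⟩ := exists_eval_cosh_eq_mul hP (2 * w : ℝ)
  have hQ1 : Q.eval 1 = P.eval (2 * w : ℝ) ^ 2 := by
    have := hQe 0
    rw [Real.cosh_zero, neg_zero, Real.exp_zero, mul_one] at this
    rw [this, sq]
  -- Put s = exp θ with u = cosh θ. Then u ≥ 5/4 forces s ≥ 2, so 2w/s ≤ w, and s ≤ 2u ≤ N/(2w)
  -- gives 2ws ≤ N.
  have hbound : ∀ u ∈ Set.Icc (5 / 4 : ℝ) (N / (4 * w)), |Q.eval u| ≤ 2 * B * (2 * C) := by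
    intro u hu
    have hu1 : (1 : ℝ) ≤ u := by linarith [hu.1]
    have hc := Real.cosh_arcosh hu1
    have hθ := Real.arcosh_nonneg hu1
    set θ := Real.arcosh u
    have hs1 : 1 ≤ Real.exp θ := Real.one_le_exp hθ
    have hmul : Real.exp θ * Real.exp (-θ) = 1 := by rw [← Real.exp_add]; simp
    have hpos := Real.exp_pos (-θ)
    rw [Real.cosh_eq] at hc
    have hs2 : 2 ≤ Real.exp θ := by
      by_contra! hlt
      nlinarith [hu.1]
    have hs3 : Real.exp (-θ) ≤ 1 / 2 := by nlinarith
    have hs4 : Real.exp θ ≤ 2 * u := by linarith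
    have hu2 := (le_div_iff₀ (by positivity)).1 hu.2
    rw [← Real.cosh_arcosh hu1, hQe, abs_mul, mul_comm]
    refine mul_le_mul ?_ ?_ (abs_nonneg _) ?_
    · refine abs_eval_le_two_mul_of_nat hPd hw hdw hB ⟨by positivity, ?_⟩
      nlinarith
    · refine abs_eval_le_two_mul_of_nat hPd (by omega) (by omega) hC ⟨by positivity, ?_⟩
      nlinarith
    · have := (abs_nonneg _).trans (hB 0 (Nat.zero_le _))
      linarith
  have hR : (5 / 2 : ℝ) ≤ N / (4 * w) := by
    rw [le_div_iff₀ (by positivity)]; linarith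
  have hdN' : (8 : ℝ) * d ^ 2 * w ≤ N := by exact_mod_cast hdN
  have hdR : 2 * (d : ℝ) ^ 2 ≤ N / (4 * w) := by
    rw [le_div_iff₀ (by positivity)]; linarith
  -- The point 1 is 1/4 to the left of the interval, so d² ≤ N/(4w) - 5/4 is required; it is the
  -- average of `hR` and `hdR`.
  have h := eval_le_two_mul_of_abs_le hQ (by linarith) (x := 1) (by norm_num)
    (by linarith) hbound
  rw [hQ1] at h
  linarith

theorem sum_powersetCard_le {N j : ℕ} {f : Finset (Fin N) → ℝ} (c : ℝ)
    (h : ∀ A : Finset (Fin N), A.card = j → f A ≤ c) :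
    ∑ A ∈ Finset.powersetCard j Finset.univ, f A ≤ N.choose j * c := by
  refine (Finset.sum_le_card_nsmul _ _ c fun A hA => h A (Finset.mem_powersetCard.1 hA).2).trans_eq
    ?_
  rw [Finset.card_powersetCard, Finset.card_univ, Fintype.card_fin, nsmul_eq_mul]

namespace QueryVerifier

variable {N m T : ℕ} (V : QueryVerifier N m T)

/-- Without queries the full set and the empty set are accepted with equal probability. -/
theorem queries_pos_of_isQMAVerifier {w : ℕ} (hN : 2 * w ≤ N)
    (hV : V.IsQMAVerifier (apxCount N w) (1 / 3)) : 0 < T := by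
  rcases Nat.eq_zero_or_pos T with rfl | h
  · obtain ⟨ψ, hψ, h1⟩ := hV.1 Finset.univ (by simpa [apxCount] using hN)
    have h2 := hV.2 ∅ (by simp [apxCount]) ψ hψ
    have h3 : V.acceptProb ∅ ψ = V.acceptProb Finset.univ ψ := rfl
    linarith
  · exact h

theorem not_isQMAVerifier_of_small {w : ℕ} (hw : 1 ≤ w) (hm : 1 ≤ m) (hN : 10 * w ≤ N)
    (hw' : 4 * (26 * (m * T)) ^ 2 ≤ w) (hN' : 8 * (26 * (m * T)) ^ 2 * w ≤ N) :
    ¬ V.IsQMAVerifier (apxCount N w) (1 / 3) := by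
  rintro ⟨hyes, hno⟩
  -- 13 is the least exponent with (4/3)^13 > 32, which makes (4/9)^13 exceed 8 · 4 / 3^13; the 8 is
  -- from `sq_eval_two_mul_le`, the 4 from two factors 2^m.
  set k := 13 * m with hk
  obtain ⟨P, hPd, hP⟩ := V.exists_polynomial_moment k
  have hchoose : ∀ j ≤ N, (0 : ℝ) < N.choose j := fun j hj => by
    exact_mod_cast Nat.choose_pos hj
  have hPle : ∀ (c : ℝ) (j : ℕ), j ≤ N →
      (∀ A : Finset (Fin N), A.card = j → ((V.acceptMatrix A ^ k).trace).re ≤ c) →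
      P.eval (j : ℝ) ≤ c := by
    intro c j hj h
    have := sum_powersetCard_le c h
    rw [hP j hj] at this
    exact le_of_mul_le_mul_left this (hchoose j hj)
  have hleP : ∀ (c : ℝ) (j : ℕ), j ≤ N →
      (∀ A : Finset (Fin N), A.card = j → c ≤ ((V.acceptMatrix A ^ k).trace).re) →
      c ≤ P.eval (j : ℝ) := by
    intro c j hj h
    have := sum_powersetCard_le (-c) fun A hA => neg_le_neg (h A hA)
    rw [Finset.sum_neg_distrib, hP j hj] at this
    have h2 : (N.choose j : ℝ) * c ≤ N.choose j * P.eval (j : ℝ) := by linarith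
    exact le_of_mul_le_mul_left h2 (hchoose j hj)
  have hP0 : ∀ j : ℕ, j ≤ N → 0 ≤ P.eval (j : ℝ) := fun j hj =>
    hleP 0 j hj fun A _ => V.re_trace_acceptMatrix_pow_nonneg A k
  have hlow : ∀ j : ℕ, j ≤ w → |P.eval (j : ℝ)| ≤ 2 ^ m * (1 / 3) ^ k := fun j hj => by
    rw [abs_of_nonneg (hP0 j (by omega))]
    exact hPle _ j (by omega) fun A hA =>
      V.re_trace_acceptMatrix_pow_le k (hno A (by simpa [apxCount, hA] using hj))
  have hall : ∀ j : ℕ, j ≤ N → |P.eval (j : ℝ)| ≤ 2 ^ m := fun j hj => by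
    rw [abs_of_nonneg (hP0 j hj)]
    refine hPle _ j hj fun A hA => ?_
    simpa using V.re_trace_acceptMatrix_pow_le k fun ψ hψ => V.acceptProb_le_one A hψ
  have hhigh : (2 / 3 : ℝ) ^ k ≤ P.eval (2 * w : ℝ) := by
    have := hleP ((2 / 3 : ℝ) ^ k) (2 * w) (by omega) fun A hA => by
      obtain ⟨ψ, hψ, h⟩ := hyes A (by simp [apxCount, hA])
      exact V.le_re_trace_acceptMatrix_pow (by norm_num) k hψ (by linarith)
    simpa using this
  have hdeg : 2 * T * k = 26 * (m * T) := by rw [hk]; ring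
  rw [hdeg] at hPd
  have h := sq_eval_two_mul_le hw hN hPd hw' hN' hlow hall
  have h2 : ((2 / 3 : ℝ) ^ k) ^ 2 ≤ 8 * (2 ^ m * (1 / 3) ^ k * 2 ^ m) :=
    (pow_le_pow_left₀ (by positivity) hhigh 2).trans h
  have e1 : ((2 / 3 : ℝ) ^ k) ^ 2 = ((4 / 9 : ℝ) ^ 13) ^ m := by
    rw [← pow_mul, mul_comm k 2, pow_mul, hk, pow_mul]; norm_num
  have e2 : (2 : ℝ) ^ m * (1 / 3) ^ k * 2 ^ m = (4 * (1 / 3) ^ 13) ^ m := by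
    rw [mul_pow, ← pow_mul, ← hk, mul_right_comm, ← mul_pow]; norm_num
  have e3 : (8 * (4 * (1 / 3 : ℝ) ^ 13)) ^ m < ((4 / 9 : ℝ) ^ 13) ^ m :=
    pow_lt_pow_left₀ (by norm_num) (by norm_num) (by omega)
  have e4 : (8 : ℝ) * (4 * (1 / 3 : ℝ) ^ 13) ^ m ≤ (8 * (4 * (1 / 3 : ℝ) ^ 13)) ^ m := by
    rw [mul_pow (8 : ℝ)]
    exact mul_le_mul_of_nonneg_right (le_self_pow₀ (by norm_num) (by omega)) (by positivity)
  rw [e1, e2] at h2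
  linarith

end QueryVerifier

theorem corollary3p5 :
    ∃ c : ℝ, 0 < c ∧
      ∀ (N w m T : ℕ), 1 ≤ w → 2 * w ≤ N → 1 ≤ m →
        ∀ V : QueryVerifier N m T, V.IsQMAVerifier (apxCount N w) (1 / 3) →
          c * min (Real.sqrt (w : ℝ)) (Real.sqrt ((N : ℝ) / (w : ℝ))) ≤ (m : ℝ) * (T : ℝ) := by
  -- 104 = 4 · 26, so (104 mT)² is 16 times the squared degree bound and covers the factors 4 and 8;
  -- with mT ≥ 1 it also gives 10w ≤ N.
  refine ⟨1 / 104, by norm_num, fun N w m T hw hN hm V hV => ?_⟩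
  by_contra! hlt
  have hT := V.queries_pos_of_isQMAVerifier hN hV
  have hw0 : (0 : ℝ) < w := by exact_mod_cast hw
  have hmT : (1 : ℝ) ≤ (m : ℝ) * T := by exact_mod_cast Nat.mul_pos hm hT
  have h1 : 104 * ((m : ℝ) * T) ≤ Real.sqrt w := by
    linarith [min_le_left (Real.sqrt w) (Real.sqrt ((N : ℝ) / w))]
  have h2 : 104 * ((m : ℝ) * T) ≤ Real.sqrt ((N : ℝ) / w) := by
    linarith [min_le_right (Real.sqrt w) (Real.sqrt ((N : ℝ) / w))]
  rw [Real.le_sqrt (by positivity) (by positivity)] at h1 h2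
  rw [le_div_iff₀ hw0] at h2
  have h1' : (104 * (m * T)) ^ 2 ≤ w := by exact_mod_cast h1
  have h2' : (104 * (m * T)) ^ 2 * w ≤ N := by exact_mod_cast h2
  have hmT' : 1 ≤ m * T := Nat.mul_pos hm hT
  refine V.not_isQMAVerifier_of_small hw hm ?_ ?_ ?_ hV
  · refine le_trans (Nat.mul_le_mul_right w ?_) h2'
    nlinarith
  · nlinarith
  · refine le_trans (Nat.mul_le_mul_right w ?_) h2'
    nlinarith
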